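/- Let $K$ be an algebraically closed field of characteristic $0$, let $V$ be a $3$-dimensional $K$-vector space with basis $v_1,v_2,v_3$ and dual basis $x_1,x_2,x_3$ of $V^*$. Let $\mathrm{GL}(V)$ act on the right on $\mathrm{Sym}^n(V^*)$ by $x_i.T=\sum_j t_{ij}x_j$ and on $\mathrm{Sym}^n(V)$ by $v.T=T^{-1}v$ (where $Tv_i=\sum_j t_{ji}v_j$). For a form $\varphi$ in one set of variables and a form $f$ in the dual variables, let $\varphi(\partial)f$ denote the result of applying to $f$ the constant coefficient differential operator obtained from $\varphi$. For a quadratic form $Q$ let $H(Q)$ be one half of its matrix of second partial derivatives, and let $\langle A,B\rangle=\sum_{i,j}a_{ij}b_{ij}$. For a ternary quartic $F\in\mathrm{Sym}^4(V^*)$ let $\psi(F)\in\mathrm{Sym}^6(V)$ be the classical contravariant of degree $3$, in symbolic notation $\psi=\tfrac16(abv)^2(bcv)^2(cav)^2$; that is, if $v=P\times Q$ and $F(sP+tQ)=as^4+4bs^3t+6cs^2t^2+4dst^3+et^4$, then $\psi(F)(v)=ace+2bcd-ad^2-b^2e-c^3$. Put $$\rho(F)=\tfrac1{144}\,F(\partial)\psi(F)\in\mathrm{Sym}^2(V),\qquad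 \tau(F)=\tfrac1{12}\,\rho(F)(\partial)F\in\mathrm{Sym}^2(V^*),$$ $$I_9(F)=\langle H(\tau(F)),H(\rho(F))\rangle,\qquad I_{12}(F)=\det H(\rho(F)).$$ Let $$\mathsf Y=\{F\in\mathrm{Sym}^4(V^*): I_{12}(F)\neq0\},\qquad \mathsf Z=\{F\in\mathrm{Sym}^4(V^*): \rho(F)=u\,(v_2^2-v_1v_3)\text{ for some }u\in K^*\},$$ and for $F\in\mathsf Z$ write $\rho(F)=u(F)(v_2^2-v_1v_3)$. Let $W$ be a $2$-dimensional $K$-vector space with coordinates $z_1,z_2$ and let $$\ell^*:\mathrm{Sym}^4(V^*)\to\mathrm{Sym}^8(W^*)\oplus\mathrm{Sym}^4(W^*)\oplus\mathrm{Sym}^0(W^*),\qquad F\mapsto(b_8,b_4,b_0),$$ be the linear isomorphism, equivariant for $\mathrm{SL}(W)$ acting on $V$ via $$\begin{pmatrix}a&b\\c&d\end{pmatrix}\mapsto\begin{pmatrix}a^2&ab&b^2\\2ac&ad+bc&2bd\\c^2&cd&d^2\end{pmatrix},$$ that is normalized by $x_1^4\mapsto z_1^8$, $x_1^2x_2^2-4x_1^3x_3\mapsto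 z_1^4$ and $(x_2^2-4x_1x_3)^2\mapsto1$. Writing $a_{ijk}$ for the coefficient of $x_1^ix_2^jx_3^k$ in $F$, its last component is $$b_0(\ell^*(F))=\frac{a_{202}}{30}-\frac{a_{121}}{30}+\frac{a_{040}}{5}.$$ A normalizing transformation of a quadratic contravariant $\rho$ is an invertible matrix $T$ such that $\rho.T$ is a non-zero multiple of $v_2^2-v_1v_3$. Then the following hold. 1. For every $F\in\mathsf Z$, $$I_9(F)=5\,u(F)^2\,b_0(\ell^*(F)).$$ 2. For every $F\in\mathsf Y$ and every normalizing transformation $T\in\mathrm{GL}_3(K)$ of $\rho(F)$, one has $b_0(\ell^*(F.T))=0$ if and only if $I_9(F)=0$, and if $b_0(\ell^*(F.T))\neq0$, then $$\left(\frac{I_9(F)}{b_0(\ell^*(F.T))}\right)^3=2000\left(\frac{I_{12}(F)}{\det(T)^2}\right)^2.$$ 3. The same identity holds universally: let $\boldsymbol F=\sum a_Ix^I$ be the universal ternary quartic over the field $K(a)$ of rational functions in its $15$ coefficients, and let $T\in\mathrm{GL}_3(L)$ be a normalizing transformation of $\rho(\boldsymbol F)$ over an extension field $L$ of $K(a)$.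 Then $b_0(\ell^*(\boldsymbol F.T))\neq0$ and $$\left(\frac{I_9(\boldsymbol F)}{b_0(\ell^*(\boldsymbol F.T))}\right)^3=2000\left(\frac{I_{12}(\boldsymbol F)}{\det(T)^2}\right)^2.$$ -/

import Mathlib

namespace TernaryQuartic

open MvPolynomial

noncomputable section

variable {R : Type*} [Field R]

/-! Ternary forms in `x₁, x₂, x₃` (elements of `Sym(V*)`) and contravariant forms in `v₁, v₂, v₃`
(elements of `Sym(V)`) are both polynomials in three variables, indexed by `0, 1, 2 : Fin 3`. -/

/-- The differential operator `φ(∂)` applied to `f`: each monomial `y₁^i₁ y₂^i₂ y₃^i₃` of `φ` acts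
as `∂^(i₁+i₂+i₃) / ∂^i₁ ∂^i₂ ∂^i₃`. This is the pairing `D` between forms in dual variables. -/
def diffOp (φ f : MvPolynomial (Fin 3) R) : MvPolynomial (Fin 3) R :=
  ∑ m ∈ φ.support,
    C (coeff m φ) * (pderiv 0)^[m 0] ((pderiv 1)^[m 1] ((pderiv 2)^[m 2] f))

/-- `H(Q)`: one half of the matrix of second partial derivatives. -/
def hessian (Q : MvPolynomial (Fin 3) R) : Matrix (Fin 3) (Fin 3) (MvPolynomial (Fin 3) R) :=
  Matrix.of fun i j => C (1 / 2) * pderiv i (pderiv j Q)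

/-- `J₁₁(Q, ρ) = ⟨H(Q), H(ρ)⟩` for ternary quadrics (the entries are constants). -/
def J11 (Q ρ : MvPolynomial (Fin 3) R) : R :=
  constantCoeff (∑ i, ∑ j, hessian Q i j * hessian ρ i j)

/-- `J₀₃(ρ) = det H(ρ)` for a ternary quadric; this is the discriminant of `ρ`. -/
def J03 (ρ : MvPolynomial (Fin 3) R) : R :=
  constantCoeff (hessian ρ).det

/-- The coefficients of the symmetric `4`-tensor `A` of a quartic form `F`, so that
`F = ∑ A i j k l xᵢ xⱼ xₖ xₗ`, arranged as a `9 × 9` matrix with rows `(i, j)` and columns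
`(k, l)`. -/
def tensorMatrix (F : MvPolynomial (Fin 3) R) :
    Matrix (Fin 3 × Fin 3) (Fin 3 × Fin 3) (MvPolynomial (Fin 3) R) :=
  Matrix.of fun p q =>
    C (1 / 24 * constantCoeff (pderiv p.1 (pderiv p.2 (pderiv q.1 (pderiv q.2 F)))))

/-- The bracket `[i j] = det(eᵢ, eⱼ, v)`, a linear form in `v`. -/
def bracket (i j : Fin 3) : MvPolynomial (Fin 3) R :=
  Matrix.det (Matrix.of ![Pi.single i 1, Pi.single j 1, X])

/-- The matrix with entry `[i k] [j l]` in row `(i, j)` and column `(k, l)`. -/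
def bracketMatrix : Matrix (Fin 3 × Fin 3) (Fin 3 × Fin 3) (MvPolynomial (Fin 3) R) :=
  Matrix.of fun p q => bracket p.1 q.1 * bracket p.2 q.2

/-- The contravariant `ψ` of degree `3` and order `6`, in symbolic notation
`(a b v)² (b c v)² (c a v)² / 6`. If `v = P × Q` and
`F (s P + t Q) = a s⁴ + 4 b s³ t + 6 c s² t² + 4 d s t³ + e t⁴`, then
`ψ(F)(v) = a c e + 2 b c d - a d² - b² e - c³`. -/
def psi (F : MvPolynomial (Fin 3) R) : MvPolynomial (Fin 3) R :=
  C (1 / 6) * ((tensorMatrix F * bracketMatrix) ^ 3).trace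

/-- The quadratic contravariant `ρ = D(F, ψ) / 144`, of degree `4`. -/
def rho (F : MvPolynomial (Fin 3) R) : MvPolynomial (Fin 3) R :=
  C (1 / 144) * diffOp F (psi F)

/-- The quadratic covariant `τ = D(F, ρ) / 12`, of degree `5`. -/
def tau (F : MvPolynomial (Fin 3) R) : MvPolynomial (Fin 3) R :=
  C (1 / 12) * diffOp (rho F) F

/-- The invariant `I₉ = J₁₁(τ, ρ)`. -/
def I9 (F : MvPolynomial (Fin 3) R) : R := J11 (tau F) (rho F)

/-- The invariant `I₁₂ = J₀₃(ρ)`. -/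
def I12 (F : MvPolynomial (Fin 3) R) : R := J03 (rho F)

/-- The normal form `v₂² - v₁ v₃`. -/
def normalQuadric : MvPolynomial (Fin 3) R := X 1 ^ 2 - X 0 * X 2

/-- The right action of `GL(V)` on `Sym(V*)`: `xᵢ . T = ∑ⱼ tᵢⱼ xⱼ`. -/
def act (F : MvPolynomial (Fin 3) R) (T : Matrix.GeneralLinearGroup (Fin 3) R) :
    MvPolynomial (Fin 3) R :=
  aeval (fun i => ∑ j, C (T.1 i j) * X j) F

/-- The right action of `GL(V)` on `Sym(V)`: `v . T = T⁻¹ . v`, where `T . vᵢ = ∑ⱼ tⱼᵢ vⱼ`. -/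
def actDual (γ : MvPolynomial (Fin 3) R) (T : Matrix.GeneralLinearGroup (Fin 3) R) :
    MvPolynomial (Fin 3) R :=
  aeval (fun i => ∑ j, C ((T⁻¹).1 j i) * X j) γ

/-- `T` is a normalizing transformation of the contravariant quadric `γ`: it sends `γ` to a
non-zero multiple of `v₂² - v₁ v₃`. -/
def IsNormalizing (T : Matrix.GeneralLinearGroup (Fin 3) R) (γ : MvPolynomial (Fin 3) R) : Prop :=
  ∃ u : R, u ≠ 0 ∧ actDual γ T = C u * normalQuadric

variable (R) in
/-- The ternary quartic forms `F` whose contravariant `ρ(F)` is nondegenerate. -/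
def Y : Set (MvPolynomial (Fin 3) R) :=
  {F | F.IsHomogeneous 4 ∧ I12 F ≠ 0}

variable (R) in
/-- The ternary quartic forms `F` whose contravariant `ρ(F)` is normalized. -/
def Z : Set (MvPolynomial (Fin 3) R) :=
  {F | F.IsHomogeneous 4 ∧ ∃ u : R, u ≠ 0 ∧ rho F = C u * normalQuadric}

/-- The exponents of the fifteen monomials `x₁⁴, x₁³x₂, x₁³x₃, …, x₃⁴`. -/
def quarticExponent : Fin 15 → Fin 3 → ℕ :=
  ![![4, 0, 0], ![3, 1, 0], ![3, 0, 1], ![2, 2, 0], ![2, 1, 1], ![2, 0, 2], ![1, 3, 0], ![1, 2, 1],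
    ![1, 1, 2], ![1, 0, 3], ![0, 4, 0], ![0, 3, 1], ![0, 2, 2], ![0, 1, 3], ![0, 0, 4]]

/-- The row vector of coefficients of a ternary quartic form. -/
def quarticCoeff (F : MvPolynomial (Fin 3) R) : Fin 15 → R :=
  fun k => coeff (Finsupp.equivFunOnFinite.symm (quarticExponent k)) F

/-- The matrix of `ℓ*` (acting on row vectors) with respect to the monomials of degree `4` in
`x₁, x₂, x₃` and the monomials `z₁⁸, z₁⁷z₂, …, z₂⁸`, `z₁⁴, z₁³z₂, …, z₂⁴`, `1`. -/
def ellStarMatrix : Matrix (Fin 15) (Fin 15) R :=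
  !![1, 0, 0, 0, 0, 0, 0, 0, 0,      0, 0, 0, 0, 0,         0;
     0, 2, 0, 0, 0, 0, 0, 0, 0,      0, 0, 0, 0, 0,         0;
     0, 0, 1, 0, 0, 0, 0, 0, 0,      -(3/14), 0, 0, 0, 0,   0;
     0, 0, 4, 0, 0, 0, 0, 0, 0,      1/7, 0, 0, 0, 0,       0;
     0, 0, 0, 2, 0, 0, 0, 0, 0,      0, -(2/7), 0, 0, 0,    0;
     0, 0, 0, 0, 1, 0, 0, 0, 0,      0, 0, -(2/7), 0, 0,    1/30;
     0, 0, 0, 8, 0, 0, 0, 0, 0,      0, 6/7, 0, 0, 0,       0;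
     0, 0, 0, 0, 4, 0, 0, 0, 0,      0, 0, -(1/7), 0, 0,    -(1/30);
     0, 0, 0, 0, 0, 2, 0, 0, 0,      0, 0, 0, -(2/7), 0,    0;
     0, 0, 0, 0, 0, 0, 1, 0, 0,      0, 0, 0, 0, -(3/14),   0;
     0, 0, 0, 0, 16, 0, 0, 0, 0,     0, 0, 24/7, 0, 0,      1/5;
     0, 0, 0, 0, 0, 8, 0, 0, 0,      0, 0, 0, 6/7, 0,       0;
     0, 0, 0, 0, 0, 0, 4, 0, 0,      0, 0, 0, 0, 1/7,       0;
     0, 0, 0, 0, 0, 0, 0, 2, 0,      0, 0, 0, 0, 0,         0;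
     0, 0, 0, 0, 0, 0, 0, 0, 1,      0, 0, 0, 0, 0,         0]

/-- A triple of binary forms of degrees `8`, `4` and `0` in the variables `z₁, z₂`. -/
structure BinaryTriple (R : Type*) [Field R] where
  b8 : MvPolynomial (Fin 2) R
  b4 : MvPolynomial (Fin 2) R
  b0 : R

/-- The linear map `ℓ* : Sym⁴(V*) → Sym⁸(W*) ⊕ Sym⁴(W*) ⊕ Sym⁰(W*)`, `F ↦ (b₈, b₄, b₀)`. -/
def ellStar (F : MvPolynomial (Fin 3) R) : BinaryTriple R where
  b8 := ∑ k : Fin 9, C (Matrix.vecMul (quarticCoeff F) ellStarMatrix ⟨k.1, by omega⟩) *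
    (X 0 ^ (8 - k.1) * X 1 ^ k.1)
  b4 := ∑ k : Fin 5, C (Matrix.vecMul (quarticCoeff F) ellStarMatrix ⟨9 + k.1, by omega⟩) *
    (X 0 ^ (4 - k.1) * X 1 ^ k.1)
  b0 := Matrix.vecMul (quarticCoeff F) ellStarMatrix 14

/-- The universal ternary quartic form `∑ a_I x^I`, over a field `L` containing the field
`K(a)` of rational functions in the fifteen coefficients `a_I`. -/
def universalQuartic (K L : Type*) [Field K] [Field L]
    [Algebra (FractionRing (MvPolynomial (Fin 15) K)) L] : MvPolynomial (Fin 3) L :=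
  ∑ k : Fin 15,
    C (algebraMap (FractionRing (MvPolynomial (Fin 15) K)) L
      (algebraMap (MvPolynomial (Fin 15) K) (FractionRing (MvPolynomial (Fin 15) K)) (X k))) *
    ∏ i, X i ^ quarticExponent k i

end

end TernaryQuartic

/-!
# The invariants `I₉` and `I₁₂` and the normal form of a ternary quartic

The identity rests on two facts about the pairing `φ(∂) f` of forms in dual variables.

* If `ρ` is a quadric, then pairing half Hessians is half of differentiating (`J11_quadric`).
  Hence `I₉(F) = ρ(∂)² F / 24` whenever `ρ = ρ(F)` is a quadric (`I9_eq_of_actDual`).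
* The operator `(v₂² - v₁v₃)²(∂)` on quartics is `120 · b₀ ∘ ℓ*` (`constantCoeff_normalQuadric_sq`).

The pairing is equivariant (`polyDiff_linSubst`). So if `T` carries `ρ(F)` to `u (v₂² - v₁v₃)`, then
`I₉(F) = ρ(F)(∂)² F / 24 = (ρ(F).T)(∂)² (F.T) / 24 = 5 u² b₀(ℓ*(F.T))`, which is `I9_eq_b0`; the
covariance of `ψ` itself plays no role. Taking determinants of Hessians gives
`I₁₂(F) / det(T)² = -u³ / 4` (`I12_eq_of_actDual`). Eliminating `u` yields the identity of cubes and
squares, as `5³ = 2000 / 4²`.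

For the universal quartic it remains to see that `I₉` does not vanish. Up to a non-zero rational
factor `I₉` has an analogue `intI9` over every commutative ring, compatible with ring homomorphisms
(`map_intI9`), so the coefficients may be specialized. The quartic `12 x₁² x₂² + x₃⁴` is a
combination of five fourth powers of linear forms. On such combinations the symbolic expression of
`ψ` becomes a trace over the linear forms (`intPsi_sum_linForm_pow`), and the value of `intI9`
turns out to be a non-zero integer.
-/

namespace TernaryQuartic

open MvPolynomial

section CommRing

variable {S S' : Type*} [CommRing S] [CommRing S']

/-! ### Constant coefficient differential operators -/

/-- The operator `φ(∂)` applied to `f`, over an arbitrary commutative ring. Over a field this is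
`diffOp`; the generality is needed to specialize the coefficients of the universal quartic. -/
noncomputable def polyDiff (φ f : MvPolynomial (Fin 3) S) : MvPolynomial (Fin 3) S :=
  ∑ m ∈ φ.support,
    C (coeff m φ) * (pderiv 0)^[m 0] ((pderiv 1)^[m 1] ((pderiv 2)^[m 2] f))

theorem polyDiff_eq_sum (φ f : MvPolynomial (Fin 3) S) :
    polyDiff φ f = Finsupp.sum (AddMonoidAlgebra.coeff φ) fun m c =>
      C c * (pderiv 0)^[m 0] ((pderiv 1)^[m 1] ((pderiv 2)^[m 2] f)) := rfl

theorem pderiv_comm (i j : Fin 3) (f : MvPolynomial (Fin 3) S) :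
    pderiv i (pderiv j f) = pderiv j (pderiv i f) := by
  ext m
  simp only [coeff_pderiv, Finsupp.add_apply, add_right_comm m]
  by_cases h : i = j
  · subst h; rfl
  · simp [h, Ne.symm h]
    ring

theorem polyDiff_add_left (φ φ' f : MvPolynomial (Fin 3) S) :
    polyDiff (φ + φ') f = polyDiff φ f + polyDiff φ' f := by
  simp only [polyDiff_eq_sum]
  exact Finsupp.sum_add_index' (by simp) (by intros; simp [add_mul])

theorem polyDiff_monomial (m : Fin 3 →₀ ℕ) (c : S) (f : MvPolynomial (Fin 3) S) :
    polyDiff (monomial m c) f =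
      C c * (pderiv 0)^[m 0] ((pderiv 1)^[m 1] ((pderiv 2)^[m 2] f)) := by
  rw [polyDiff_eq_sum]
  exact Finsupp.sum_single_index (by simp)

theorem polyDiff_C (c : S) (f : MvPolynomial (Fin 3) S) : polyDiff (C c) f = C c * f := by
  rw [← monomial_zero', polyDiff_monomial]; simp

theorem polyDiff_mul_X (φ f : MvPolynomial (Fin 3) S) (i : Fin 3) :
    polyDiff (φ * X i) f = pderiv i (polyDiff φ f) := by
  induction φ using MvPolynomial.induction_on' with
  | add p q hp hq => rw [add_mul, polyDiff_add_left, hp, hq, polyDiff_add_left, map_add]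
  | monomial m c =>
    have hc : ∀ j k : Fin 3, Function.Commute
        (pderiv j : MvPolynomial (Fin 3) S → MvPolynomial (Fin 3) S) (pderiv k) :=
      fun j k f => pderiv_comm j k f
    rw [X, monomial_mul, polyDiff_monomial, polyDiff_monomial, pderiv_C_mul, mul_one]
    congr 1
    fin_cases i
    · simp [Function.iterate_succ_apply']
    · simp [Function.iterate_succ_apply']
      rw [((hc 0 1).iterate_left _).eq]
    · simp [Function.iterate_succ_apply']
      rw [((hc 1 2).iterate_left _).eq, ((hc 0 2).iterate_left _).eq]

theorem polyDiff_C_mul (c : S) (φ f : MvPolynomial (Fin 3) S) :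
    polyDiff (C c * φ) f = C c * polyDiff φ f := by
  induction φ using MvPolynomial.induction_on with
  | C a => rw [← C_mul, polyDiff_C, polyDiff_C, C_mul, mul_assoc]
  | add p q hp hq => rw [mul_add, polyDiff_add_left, hp, hq, polyDiff_add_left, mul_add]
  | mul_X p i hp => rw [← mul_assoc, polyDiff_mul_X, hp, polyDiff_mul_X, pderiv_C_mul]

theorem polyDiff_C_mul_right (c : S) (φ f : MvPolynomial (Fin 3) S) :
    polyDiff φ (C c * f) = C c * polyDiff φ f := by
  induction φ using MvPolynomial.induction_on with
  | C a => rw [polyDiff_C, polyDiff_C]; ring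
  | add p q hp hq => rw [polyDiff_add_left, hp, hq, polyDiff_add_left, mul_add]
  | mul_X p i hp => rw [polyDiff_mul_X, hp, polyDiff_mul_X, pderiv_C_mul]

theorem polyDiff_sum_left {ι : Type*} (s : Finset ι) (φ : ι → MvPolynomial (Fin 3) S)
    (f : MvPolynomial (Fin 3) S) :
    polyDiff (∑ i ∈ s, φ i) f = ∑ i ∈ s, polyDiff (φ i) f := by
  classical
  induction s using Finset.induction_on with
  | empty => simp [polyDiff]
  | insert a s ha ih => rw [Finset.sum_insert ha, Finset.sum_insert ha, polyDiff_add_left, ih]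

theorem map_polyDiff (g : S →+* S') (φ f : MvPolynomial (Fin 3) S) :
    map g (polyDiff φ f) = polyDiff (map g φ) (map g f) := by
  induction φ using MvPolynomial.induction_on with
  | C a => rw [polyDiff_C, map_mul, map_C, polyDiff_C]
  | add p q hp hq => rw [polyDiff_add_left, map_add, hp, hq, map_add, polyDiff_add_left]
  | mul_X p i hp =>
    rw [polyDiff_mul_X, ← pderiv_map, hp, map_mul, map_X, polyDiff_mul_X]

/-! ### Linear substitutions -/

/-- The linear substitution `xᵢ ↦ ∑ⱼ mᵢⱼ xⱼ`. -/
noncomputable def linSubst (M : Matrix (Fin 3) (Fin 3) S) :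
    MvPolynomial (Fin 3) S →ₐ[S] MvPolynomial (Fin 3) S :=
  aeval fun i => ∑ j, C (M i j) * X j

theorem linSubst_X (M : Matrix (Fin 3) (Fin 3) S) (i : Fin 3) :
    linSubst M (X i) = ∑ j, C (M i j) * X j := aeval_X _ _

theorem linSubst_C (M : Matrix (Fin 3) (Fin 3) S) (c : S) : linSubst M (C c) = C c :=
  aeval_C _ _

theorem linSubst_one : linSubst (1 : Matrix (Fin 3) (Fin 3) S) = AlgHom.id S _ := by
  ext1 i
  rw [linSubst_X]
  simp [Matrix.one_apply]

theorem linSubst_linSubst (M N : Matrix (Fin 3) (Fin 3) S) (f : MvPolynomial (Fin 3) S) :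
    linSubst M (linSubst N f) = linSubst (N * M) f := by
  suffices h : (linSubst M).comp (linSubst N) = linSubst (N * M) from congr($h f)
  ext1 i
  simp only [AlgHom.comp_apply, linSubst_X, map_sum, map_mul, linSubst_C, Matrix.mul_apply,
    Finset.mul_sum, Finset.sum_mul, mul_assoc]
  rw [Finset.sum_comm]

theorem constantCoeff_linSubst (M : Matrix (Fin 3) (Fin 3) S) (f : MvPolynomial (Fin 3) S) :
    constantCoeff (linSubst M f) = constantCoeff f := by
  induction f using MvPolynomial.induction_on with
  | C a => rw [linSubst_C]
  | add p q hp hq => simp only [map_add, hp, hq]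
  | mul_X p i hp => simp [linSubst_X]

/-- The chain rule for a linear substitution. -/
theorem pderiv_linSubst (M : Matrix (Fin 3) (Fin 3) S) (j : Fin 3)
    (f : MvPolynomial (Fin 3) S) :
    pderiv j (linSubst M f) = ∑ k, C (M k j) * linSubst M (pderiv k f) := by
  induction f using MvPolynomial.induction_on with
  | C a => simp
  | add p q hp hq => simp only [map_add, hp, hq, mul_add, Finset.sum_add_distrib]
  | mul_X p i hp =>
    have h : pderiv j (linSubst M (X i)) = C (M i j) := by
      simp [linSubst_X, pderiv_X, Pi.single_apply]
    simp only [map_mul, pderiv_mul, hp, h, map_add, mul_add, Finset.sum_add_distrib]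
    simp [pderiv_X, Pi.single_apply, Finset.mul_sum, mul_left_comm, mul_comm]

/-- The pairing of forms in dual variables is equivariant: substituting by `M` in `f` and by the
transposed inverse of `M` in `φ` substitutes by `M` in `φ(∂) f`. -/
theorem polyDiff_linSubst {M N : Matrix (Fin 3) (Fin 3) S} (h : M * N = 1)
    (φ f : MvPolynomial (Fin 3) S) :
    polyDiff (linSubst N.transpose φ) (linSubst M f) = linSubst M (polyDiff φ f) := by
  induction φ using MvPolynomial.induction_on with
  | C a => rw [linSubst_C, polyDiff_C, polyDiff_C, map_mul, linSubst_C]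
  | add p q hp hq => rw [map_add, polyDiff_add_left, hp, hq, polyDiff_add_left, map_add]
  | mul_X p i hp =>
    have hMN : ∀ k, ∑ j, N j i * M k j = if k = i then 1 else 0 := fun k => by
      rw [← Matrix.one_apply, ← h, Matrix.mul_apply]
      exact Finset.sum_congr rfl fun j _ => mul_comm _ _
    rw [map_mul, linSubst_X, Finset.mul_sum, polyDiff_sum_left, polyDiff_mul_X]
    have hC : ∀ j, linSubst N.transpose p * (C (N.transpose i j) * X j) =
        C (N j i) * (linSubst N.transpose p * X j) := fun j => by
      rw [mul_left_comm, Matrix.transpose_apply]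
    simp only [hC, polyDiff_C_mul, polyDiff_mul_X, hp, pderiv_linSubst,
      Finset.mul_sum]
    rw [Finset.sum_comm]
    simp only [← mul_assoc, ← Finset.sum_mul, ← C_mul, ← map_sum, hMN]
    simp

end CommRing

/-! ### The invariants in terms of the normal form -/

section Field

variable {R : Type*} [Field R]

theorem diffOp_eq_polyDiff (φ f : MvPolynomial (Fin 3) R) : diffOp φ f = polyDiff φ f := rfl

theorem act_eq_linSubst (F : MvPolynomial (Fin 3) R) (T : Matrix.GeneralLinearGroup (Fin 3) R) :
    act F T = linSubst T.1 F := rfl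

theorem actDual_eq_linSubst (γ : MvPolynomial (Fin 3) R)
    (T : Matrix.GeneralLinearGroup (Fin 3) R) :
    actDual γ T = linSubst (T⁻¹).1.transpose γ := rfl

theorem polyDiff_quadric (s : Fin 3 → Fin 3 → R) (f : MvPolynomial (Fin 3) R) :
    polyDiff (∑ i, ∑ j, C (s i j) * (X i * X j)) f =
      ∑ i, ∑ j, C (s i j) * pderiv i (pderiv j f) := by
  simp only [polyDiff_sum_left, polyDiff_C_mul, polyDiff_mul_X]
  refine Finset.sum_congr rfl fun i _ => Finset.sum_congr rfl fun j _ => ?_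
  rw [← one_mul (X i), ← C_1, polyDiff_mul_X, polyDiff_C, C_1, one_mul, pderiv_comm]

/-- For quadrics, the pairing of half Hessians is half of the pairing by differentiation. -/
theorem J11_quadric [CharZero R] (s : Fin 3 → Fin 3 → R) (q : MvPolynomial (Fin 3) R) :
    J11 q (∑ i, ∑ j, C (s i j) * (X i * X j)) =
      1 / 2 * constantCoeff (polyDiff (∑ i, ∑ j, C (s i j) * (X i * X j)) q) := by
  rw [polyDiff_quadric]
  have h10 := pderiv_comm 1 0 q
  have h20 := pderiv_comm 2 0 q
  have h21 := pderiv_comm 2 1 q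
  simp only [J11, hessian, Matrix.of_apply, Fin.sum_univ_three, h10, h20, h21]
  simp [pderiv_X]
  ring

theorem polyDiff_C_mul_normalQuadric (u : R) (f : MvPolynomial (Fin 3) R) :
    polyDiff (C u * normalQuadric) f =
      C u * (pderiv 1 (pderiv 1 f) - pderiv 0 (pderiv 2 f)) := by
  have h : (normalQuadric : MvPolynomial (Fin 3) R) =
      C 1 * X 1 * X 1 + C (-1) * X 2 * X 0 := by
    simp only [normalQuadric, C_1, C_neg]; ring
  rw [polyDiff_C_mul, h, polyDiff_add_left]
  simp only [polyDiff_mul_X, polyDiff_C, pderiv_C_mul]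
  simp only [C_1, C_neg]
  ring

/-- Up to a factor, `b₀ ∘ ℓ*` is the operator `(v₂² - v₁v₃)²(∂)`, the `SL(W)`-invariant linear
form on quartics. -/
theorem constantCoeff_normalQuadric_sq [CharZero R] (u : R) (G : MvPolynomial (Fin 3) R) :
    constantCoeff (polyDiff (C u * normalQuadric) (polyDiff (C u * normalQuadric) G)) =
      120 * u ^ 2 * (ellStar G).b0 := by
  -- the exponents produced by `coeff_pderiv`, in the form used by `quarticCoeff`
  have key : ∀ (m : Fin 3 →₀ ℕ) (a b c : ℕ), m 0 = a → m 1 = b → m 2 = c →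
      m = Finsupp.equivFunOnFinite.symm ![a, b, c] := by
    rintro m a b c rfl rfl rfl
    ext i; fin_cases i <;> rfl
  have h040 := key (0 + Finsupp.single 1 1 + Finsupp.single 1 1 + Finsupp.single 1 1 +
    Finsupp.single 1 1) 0 4 0 (by simp) (by simp)
    (by simp)
  have h121 := key (0 + Finsupp.single 1 1 + Finsupp.single 1 1 + Finsupp.single 0 1 +
    Finsupp.single 2 1) 1 2 1 (by simp) (by simp)
    (by simp)
  have h121' := key (0 + Finsupp.single 0 1 + Finsupp.single 2 1 + Finsupp.single 1 1 +
    Finsupp.single 1 1) 1 2 1 (by simp) (by simp)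
    (by simp)
  have h202 := key (0 + Finsupp.single 0 1 + Finsupp.single 2 1 + Finsupp.single 0 1 +
    Finsupp.single 2 1) 2 0 2 (by simp) (by simp)
    (by simp)
  have hb : (ellStar G).b0 =
      coeff (Finsupp.equivFunOnFinite.symm ![2, 0, 2]) G * (1 / 30) -
      coeff (Finsupp.equivFunOnFinite.symm ![1, 2, 1]) G * (1 / 30) +
      coeff (Finsupp.equivFunOnFinite.symm ![0, 4, 0]) G * (1 / 5) := by
    simp [ellStar, Matrix.vecMul, dotProduct, Fin.sum_univ_succ, ellStarMatrix, quarticCoeff,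
      quarticExponent]
    ring
  rw [hb]
  simp only [polyDiff_C_mul_normalQuadric, pderiv_C_mul, map_sub, map_mul, constantCoeff_C,
    constantCoeff_eq, coeff_pderiv, h040, h121, h121', h202]
  simp
  ring

/-- A contravariant in the orbit of a multiple of `v₂² - v₁v₃` is a quadric, so the Hessian
pairing defining `I₉` becomes a differentiation. -/
theorem I9_eq_of_actDual [CharZero R] {F : MvPolynomial (Fin 3) R}
    {T : Matrix.GeneralLinearGroup (Fin 3) R} {u : R}
    (h : actDual (rho F) T = C u * normalQuadric) :
    I9 F = 1 / 24 * constantCoeff (polyDiff (rho F) (polyDiff (rho F) F)) := by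
  -- `ρ(F)` is recovered from its normal form by the substitution inverse to that of `T`
  obtain ⟨s, hs⟩ : ∃ s : Fin 3 → Fin 3 → R,
      rho F = ∑ i, ∑ j, C (s i j) * (X i * X j) := by
    set M : Matrix (Fin 3) (Fin 3) R := T.1.transpose with hM
    refine ⟨fun i j => u * (M 1 i * M 1 j - M 0 i * M 2 j), ?_⟩
    have h1 : linSubst M (linSubst (T⁻¹).1.transpose (rho F)) = rho F := by
      rw [linSubst_linSubst, hM, ← Matrix.transpose_mul, ← Units.val_mul, mul_inv_cancel,
        Units.val_one, Matrix.transpose_one, linSubst_one, AlgHom.id_apply]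
    rw [← h1, ← actDual_eq_linSubst, h]
    simp only [normalQuadric, map_mul, map_sub, map_pow, linSubst_C, linSubst_X,
      Fin.sum_univ_three]
    ring
  have hJ := J11_quadric s (tau F)
  rw [← hs] at hJ
  rw [I9, hJ, tau, diffOp_eq_polyDiff, polyDiff_C_mul_right, map_mul, constantCoeff_C]
  ring

theorem I9_eq_b0 [CharZero R] {F : MvPolynomial (Fin 3) R}
    {T : Matrix.GeneralLinearGroup (Fin 3) R} {u : R}
    (h : actDual (rho F) T = C u * normalQuadric) :
    I9 F = 5 * u ^ 2 * (ellStar (act F T)).b0 := by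
  have hT : T.1 * (T⁻¹).1 = 1 := by rw [← Units.val_mul, mul_inv_cancel, Units.val_one]
  rw [I9_eq_of_actDual h, ← constantCoeff_linSubst T.1, ← polyDiff_linSubst hT,
    ← polyDiff_linSubst hT, ← actDual_eq_linSubst, h, ← act_eq_linSubst,
    constantCoeff_normalQuadric_sq]
  ring

theorem J03_linSubst (M : Matrix (Fin 3) (Fin 3) R) (q : MvPolynomial (Fin 3) R) :
    J03 (linSubst M q) = M.det ^ 2 * J03 q := by
  have h : (constantCoeff (σ := Fin 3) (R := R)).mapMatrix (hessian (linSubst M q)) =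
      M.transpose * constantCoeff.mapMatrix (hessian q) * M := by
    ext i j
    simp only [RingHom.mapMatrix_apply, Matrix.map_apply, hessian, Matrix.of_apply,
      Matrix.mul_apply, Matrix.transpose_apply, pderiv_linSubst, map_sum, pderiv_C_mul, map_mul,
      constantCoeff_C, constantCoeff_linSubst, Finset.mul_sum, Finset.sum_mul]
    refine Finset.sum_congr rfl fun k _ => Finset.sum_congr rfl fun l _ => ?_
    rw [pderiv_comm]
    ring
  simp only [J03, RingHom.map_det, h, Matrix.det_mul, Matrix.det_transpose]
  ring

theorem J03_C_mul_normalQuadric [CharZero R] (u : R) :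
    J03 (C u * normalQuadric) = -(u ^ 3 / 4) := by
  have h2 : constantCoeff (2 : MvPolynomial (Fin 3) R) = 2 := map_ofNat _ 2
  simp only [J03, hessian, Matrix.det_fin_three, Matrix.of_apply, normalQuadric, pderiv_C_mul]
  simp [pderiv_X, h2]
  ring

theorem I12_eq_of_actDual [CharZero R] {F : MvPolynomial (Fin 3) R}
    {T : Matrix.GeneralLinearGroup (Fin 3) R} {u : R}
    (h : actDual (rho F) T = C u * normalQuadric) :
    I12 F / T.1.det ^ 2 = -(u ^ 3 / 4) := by
  have hdet : T.1.det * (T⁻¹).1.det = 1 := by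
    rw [← Matrix.det_mul, ← Units.val_mul, mul_inv_cancel, Units.val_one, Matrix.det_one]
  have h0 : T.1.det ≠ 0 := left_ne_zero_of_mul_eq_one hdet
  rw [← J03_C_mul_normalQuadric, ← h, actDual_eq_linSubst, J03_linSubst, Matrix.det_transpose,
    I12, eq_inv_of_mul_eq_one_right hdet]
  field_simp

theorem I9_eq_zero_iff [CharZero R] {F : MvPolynomial (Fin 3) R}
    {T : Matrix.GeneralLinearGroup (Fin 3) R} (h : IsNormalizing T (rho F)) :
    (ellStar (act F T)).b0 = 0 ↔ I9 F = 0 := by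
  obtain ⟨u, hu, h⟩ := h
  simp [I9_eq_b0 h, hu]

theorem I9_div_b0_pow [CharZero R] {F : MvPolynomial (Fin 3) R}
    {T : Matrix.GeneralLinearGroup (Fin 3) R} (h : IsNormalizing T (rho F))
    (hb : (ellStar (act F T)).b0 ≠ 0) :
    (I9 F / (ellStar (act F T)).b0) ^ 3 = 2000 * (I12 F / T.1.det ^ 2) ^ 2 := by
  obtain ⟨u, -, h⟩ := h
  rw [I12_eq_of_actDual h, I9_eq_b0 h, mul_div_cancel_right₀ _ hb]
  ring

end Field

/-! ### Integral forms of the contravariants -/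

section Integral

variable {S S' : Type*} [CommRing S] [CommRing S']

/-- `24` times the tensor matrix, over an arbitrary commutative ring. -/
noncomputable def intTensor (F : MvPolynomial (Fin 3) S) :
    Matrix (Fin 3 × Fin 3) (Fin 3 × Fin 3) (MvPolynomial (Fin 3) S) :=
  Matrix.of fun p q =>
    C (constantCoeff (pderiv p.1 (pderiv p.2 (pderiv q.1 (pderiv q.2 F)))))

/-- The matrix of products of brackets, over an arbitrary commutative ring. -/
noncomputable def intBracket (S : Type*) [CommRing S] :
    Matrix (Fin 3 × Fin 3) (Fin 3 × Fin 3) (MvPolynomial (Fin 3) S) :=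
  Matrix.of fun p q =>
    Matrix.det (Matrix.of ![Pi.single p.1 1, Pi.single q.1 1, X]) *
      Matrix.det (Matrix.of ![Pi.single p.2 1, Pi.single q.2 1, X])

/-- `6 · 24³` times the contravariant `ψ`. -/
noncomputable def intPsi (F : MvPolynomial (Fin 3) S) : MvPolynomial (Fin 3) S :=
  ((intTensor F * intBracket S) ^ 3).trace

/-- `144 · 6 · 24³` times the contravariant `ρ`. -/
noncomputable def intRho (F : MvPolynomial (Fin 3) S) : MvPolynomial (Fin 3) S :=
  polyDiff F (intPsi F)

/-- The value of `ρ(∂)² F`, with `ρ` replaced by its integral multiple. -/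
noncomputable def intI9 (F : MvPolynomial (Fin 3) S) : S :=
  constantCoeff (polyDiff (intRho F) (polyDiff (intRho F) F))

theorem map_intPsi (g : S →+* S') (F : MvPolynomial (Fin 3) S) :
    map g (intPsi F) = intPsi (map g F) := by
  have hA : (map g : MvPolynomial (Fin 3) S →+* _).mapMatrix (intTensor F) =
      intTensor (map g F) := by
    ext1 p q
    simp [intTensor, pderiv_map, constantCoeff_map]
  have hB : (map g : MvPolynomial (Fin 3) S →+* _).mapMatrix (intBracket S) = intBracket S' := by
    ext1 p q
    simp only [intBracket, RingHom.mapMatrix_apply, Matrix.map_apply, Matrix.of_apply,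
      Matrix.det_fin_three, map_mul, map_add, map_sub]
    simp [Pi.single_apply, apply_ite (map g)]
  rw [intPsi, intPsi, ← hA, ← hB, ← map_mul, ← map_pow, RingHom.mapMatrix_apply,
    ← AddMonoidHom.map_trace]

theorem map_intI9 (g : S →+* S') (F : MvPolynomial (Fin 3) S) :
    g (intI9 F) = intI9 (map g F) := by
  rw [intI9, intI9, intRho, intRho, ← map_intPsi, ← map_polyDiff, ← map_polyDiff, ← map_polyDiff,
    constantCoeff_map]

theorem rho_eq_intRho {R : Type*} [Field R] (F : MvPolynomial (Fin 3) R) :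
    rho F = C (1 / 144 * (1 / 6 * (1 / 24) ^ 3)) * intRho F := by
  have hA : tensorMatrix F = (C (1 / 24) : MvPolynomial (Fin 3) R) • intTensor F := by
    ext1 p q
    simp [tensorMatrix, intTensor]
  have hB : (bracketMatrix : Matrix _ _ (MvPolynomial (Fin 3) R)) = intBracket R := rfl
  rw [rho, psi, hA, hB, Matrix.smul_mul, smul_pow, Matrix.trace_smul, smul_eq_mul, ← mul_assoc,
    ← C_pow, ← C_mul, diffOp_eq_polyDiff, polyDiff_C_mul_right, ← mul_assoc, ← C_mul]
  rfl

theorem I9_eq_intI9 {R : Type*} [Field R] [CharZero R] {F : MvPolynomial (Fin 3) R}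
    {T : Matrix.GeneralLinearGroup (Fin 3) R} (h : IsNormalizing T (rho F)) :
    I9 F = 1 / 24 * (1 / 144 * (1 / 6 * (1 / 24) ^ 3)) ^ 2 * intI9 F := by
  obtain ⟨u, -, h⟩ := h
  rw [I9_eq_of_actDual h, rho_eq_intRho, intI9]
  generalize (1 / 144 * (1 / 6 * (1 / 24) ^ 3) : R) = c
  simp only [polyDiff_C_mul, polyDiff_C_mul_right, map_mul, constantCoeff_C]
  ring

end Integral

/-! ### Non-vanishing of `I₉` on the universal quartic -/

section Universal

variable {S : Type*} [CommRing S]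

theorem pderiv_ofNat (i : Fin 3) (n : ℕ) [n.AtLeastTwo] :
    pderiv i (ofNat(n) : MvPolynomial (Fin 3) S) = 0 :=
  (pderiv i).map_natCast n

theorem C_ofNat (n : ℕ) [n.AtLeastTwo] :
    C (ofNat(n) : S) = (ofNat(n) : MvPolynomial (Fin 3) S) := map_ofNat _ n

/-- The linear form with coefficient vector `a`. -/
noncomputable def linForm (a : Fin 3 → S) : MvPolynomial (Fin 3) S := ∑ j, C (a j) * X j

theorem pderiv_C_mul_linForm_pow (a : Fin 3 → S) (c : S) (n : ℕ) (i : Fin 3) :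
    pderiv i (C c * linForm a ^ (n + 1)) = C (c * (n + 1) * a i) * linForm a ^ n := by
  have h : pderiv i (linForm a) = C (a i) := by
    simp [linForm, pderiv_X, Pi.single_apply]
  rw [pderiv_C_mul, pderiv_pow, h]
  simp
  ring

/-- The bracket `det(a, b, v)` of two coefficient vectors. -/
noncomputable def vecBracket (a b : Fin 3 → S) : MvPolynomial (Fin 3) S :=
  Matrix.det (Matrix.of ![fun i => C (a i), fun i => C (b i), X])

/-- The symbolic form of `ψ` on a combination of fourth powers of linear forms: the nine by nine
trace collapses to a trace indexed by the linear forms. -/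
theorem intPsi_sum_linForm_pow {ι : Type*} [Fintype ι] [DecidableEq ι] (c : ι → S)
    (a : ι → Fin 3 → S) :
    intPsi (∑ m, C (c m) * linForm (a m) ^ 4) = 24 ^ 3 *
      ((Matrix.of fun m n => vecBracket (a m) (a n) ^ 2 * C (c n)) ^ 3).trace := by
  set U : Matrix (Fin 3 × Fin 3) ι (MvPolynomial (Fin 3) S) :=
    Matrix.of fun p m => C (c m * a m p.1 * a m p.2) with hU
  set V : Matrix ι (Fin 3 × Fin 3) (MvPolynomial (Fin 3) S) :=
    Matrix.of fun m p => C (a m p.1 * a m p.2) with hV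
  have hA : intTensor (∑ m, C (c m) * linForm (a m) ^ 4) =
      (24 : MvPolynomial (Fin 3) S) • (U * V) := by
    ext1 p q
    have h24 : (24 : MvPolynomial (Fin 3) S) = C 24 := (map_ofNat C 24).symm
    simp only [intTensor, Matrix.of_apply, map_sum, pderiv_C_mul_linForm_pow, Matrix.smul_apply,
      Matrix.mul_apply, hU, hV, smul_eq_mul, Finset.mul_sum, pow_zero, mul_one, constantCoeff_C,
      h24, ← C_mul]
    refine Finset.sum_congr rfl fun m _ => congrArg C ?_
    push_cast
    ring
  have hG : V * intBracket S * U =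
      Matrix.of fun m n => vecBracket (a m) (a n) ^ 2 * C (c n) := by
    ext1 m n
    simp only [hU, hV, Matrix.mul_apply, intBracket, Matrix.of_apply,
      Fintype.sum_prod_type, Fin.sum_univ_three, vecBracket, Matrix.det_fin_three]
    simp
    ring
  rw [intPsi, hA, ← hG, Matrix.smul_mul, smul_pow, Matrix.trace_smul, smul_eq_mul]
  congr 1
  simp only [pow_succ, pow_zero, one_mul, Matrix.mul_assoc]
  rw [Matrix.trace_mul_comm]
  simp only [Matrix.mul_assoc]

/-- The value of `6 · 24³ ψ`, read off from
`12 x₁² x₂² = (x₁ + x₂)⁴ + (x₁ - x₂)⁴ - 2 x₁⁴ - 2 x₂⁴`. -/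
theorem intPsi_sample :
    intPsi (C 12 * X 0 ^ 2 * X 1 ^ 2 + X 2 ^ 4 : MvPolynomial (Fin 3) S) =
      C (-663552) * X 2 ^ 6 + C (-995328) * (X 0 ^ 2 * X 1 ^ 2 * X 2 ^ 2) := by
  have hF : (C 12 * X 0 ^ 2 * X 1 ^ 2 + X 2 ^ 4 : MvPolynomial (Fin 3) S) =
      ∑ m, C ((![1, 1, -2, -2, 1] : Fin 5 → S) m) * linForm ((![![1, 1, 0], ![1, -1, 0],
        ![1, 0, 0], ![0, 1, 0], ![0, 0, 1]] : Fin 5 → Fin 3 → S) m) ^ 4 := by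
    simp [Fin.sum_univ_succ, linForm, C_ofNat]
    ring
  rw [hF, intPsi_sum_linForm_pow]
  simp only [pow_succ _ 2, pow_two (Matrix.of _), Matrix.trace, Matrix.diag_apply,
    Matrix.mul_apply, Matrix.of_apply, Fin.sum_univ_five, vecBracket, Matrix.det_fin_three]
  simp [C_ofNat]
  ring

theorem intRho_sample :
    intRho (C 12 * X 0 ^ 2 * X 1 ^ 2 + X 2 ^ 4 : MvPolynomial (Fin 3) S) =
      C (-286654464) * X 2 ^ 2 := by
  have hF : (C 12 * X 0 ^ 2 * X 1 ^ 2 + X 2 ^ 4 : MvPolynomial (Fin 3) S) =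
      C 12 * X 0 * X 0 * X 1 * X 1 + C 1 * X 2 * X 2 * X 2 * X 2 := by
    rw [C_1]; ring
  rw [intRho, intPsi_sample, hF, polyDiff_add_left]
  simp only [polyDiff_mul_X, polyDiff_C, pderiv_C_mul, map_add]
  simp [pderiv_X, pderiv_ofNat, C_ofNat]
  ring

theorem intI9_sample :
    intI9 (C 12 * X 0 ^ 2 * X 1 ^ 2 + X 2 ^ 4 : MvPolynomial (Fin 3) S) =
      24 * 286654464 ^ 2 := by
  rw [intI9, intRho_sample]
  simp only [pow_two (X _), ← mul_assoc, polyDiff_mul_X, polyDiff_C]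
  have h (n : ℕ) [n.AtLeastTwo] :
      constantCoeff (ofNat(n) : MvPolynomial (Fin 3) S) = ofNat(n) := map_ofNat _ n
  simp [pderiv_X, pderiv_ofNat, h]
  ring

/-- The universal quartic with coefficients in the polynomial ring. -/
noncomputable def polyQuartic (K : Type*) [CommRing K] :
    MvPolynomial (Fin 3) (MvPolynomial (Fin 15) K) :=
  ∑ k : Fin 15, C (X k) * ∏ i, X i ^ quarticExponent k i

theorem intI9_polyQuartic_ne_zero (K : Type*) [Field K] [CharZero K] :
    intI9 (polyQuartic K) ≠ 0 := by
  intro h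
  -- the point whose coordinates are the coefficients of `12 x₁² x₂² + x₃⁴`
  have h1 := map_intI9 (eval (Pi.single 3 12 + Pi.single 14 1 : Fin 15 → K)) (polyQuartic K)
  have h2 : map (eval (Pi.single 3 12 + Pi.single 14 1 : Fin 15 → K)) (polyQuartic K) =
      C 12 * X 0 ^ 2 * X 1 ^ 2 + X 2 ^ 4 := by
    simp [polyQuartic, Fin.sum_univ_succ, Fin.prod_univ_three, quarticExponent, Fin.ext_iff]
    ring
  rw [h, h2, intI9_sample, map_zero] at h1
  norm_num at h1

theorem I9_universalQuartic_ne_zero (K L : Type*) [Field K] [CharZero K] [Field L] [CharZero L]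
    [Algebra (FractionRing (MvPolynomial (Fin 15) K)) L]
    {T : Matrix.GeneralLinearGroup (Fin 3) L}
    (h : IsNormalizing T (rho (universalQuartic K L))) :
    I9 (universalQuartic K L) ≠ 0 := by
  set g : MvPolynomial (Fin 15) K →+* L :=
    (algebraMap (FractionRing (MvPolynomial (Fin 15) K)) L).comp
      (algebraMap (MvPolynomial (Fin 15) K) (FractionRing (MvPolynomial (Fin 15) K))) with hg
  have hinj : Function.Injective g :=
    (algebraMap (FractionRing (MvPolynomial (Fin 15) K)) L).injective.comp
      (IsFractionRing.injective _ _)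
  have hmap : map g (polyQuartic K) = universalQuartic K L := by
    simp [polyQuartic, universalQuartic, hg]
  rw [I9_eq_intI9 h, ← hmap, ← map_intI9]
  refine mul_ne_zero (by norm_num) ?_
  rw [Ne, map_eq_zero_iff g hinj]
  exact intI9_polyQuartic_ne_zero K

end Universal

end TernaryQuartic

theorem mainTheorem5 (K : Type*) [Field K] [IsAlgClosed K] [CharZero K] :
    (∀ F ∈ TernaryQuartic.Z K, ∀ u : K,
      TernaryQuartic.rho F = MvPolynomial.C u * TernaryQuartic.normalQuadric →
        TernaryQuartic.I9 F = 5 * u ^ 2 * (TernaryQuartic.ellStar F).b0) ∧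
    (∀ F ∈ TernaryQuartic.Y K, ∀ T : Matrix.GeneralLinearGroup (Fin 3) K,
      TernaryQuartic.IsNormalizing T (TernaryQuartic.rho F) →
        ((TernaryQuartic.ellStar (TernaryQuartic.act F T)).b0 = 0 ↔ TernaryQuartic.I9 F = 0) ∧
        ((TernaryQuartic.ellStar (TernaryQuartic.act F T)).b0 ≠ 0 →
          (TernaryQuartic.I9 F / (TernaryQuartic.ellStar (TernaryQuartic.act F T)).b0) ^ 3 =
            2000 * (TernaryQuartic.I12 F / T.1.det ^ 2) ^ 2)) ∧
    (∀ (L : Type*) [Field L] [Algebra (FractionRing (MvPolynomial (Fin 15) K)) L]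
      (T : Matrix.GeneralLinearGroup (Fin 3) L),
      TernaryQuartic.IsNormalizing T
          (TernaryQuartic.rho (TernaryQuartic.universalQuartic K L)) →
        (TernaryQuartic.ellStar
            (TernaryQuartic.act (TernaryQuartic.universalQuartic K L) T)).b0 ≠ 0 ∧
        (TernaryQuartic.I9 (TernaryQuartic.universalQuartic K L) /
            (TernaryQuartic.ellStar
              (TernaryQuartic.act (TernaryQuartic.universalQuartic K L) T)).b0) ^ 3 =
          2000 * (TernaryQuartic.I12 (TernaryQuartic.universalQuartic K L) /
            T.1.det ^ 2) ^ 2) := by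
  refine ⟨fun F _ u h => ?_, fun F _ T h => ?_, fun L _ _ T h => ?_⟩
  · have h1 : TernaryQuartic.actDual (TernaryQuartic.rho F) 1 =
        MvPolynomial.C u * TernaryQuartic.normalQuadric := by
      rw [TernaryQuartic.actDual_eq_linSubst, inv_one, Units.val_one, Matrix.transpose_one,
        TernaryQuartic.linSubst_one, AlgHom.id_apply, h]
    rw [TernaryQuartic.I9_eq_b0 h1, TernaryQuartic.act_eq_linSubst, Units.val_one,
      TernaryQuartic.linSubst_one, AlgHom.id_apply]
  · exact ⟨TernaryQuartic.I9_eq_zero_iff h, TernaryQuartic.I9_div_b0_pow h⟩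
  · have : CharZero L := charZero_of_injective_algebraMap
      (algebraMap (FractionRing (MvPolynomial (Fin 15) K)) L).injective
    have hb := (TernaryQuartic.I9_eq_zero_iff h).not.mpr
      (TernaryQuartic.I9_universalQuartic_ne_zero K L h)
    exact ⟨hb, TernaryQuartic.I9_div_b0_pow h hb⟩
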